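/- Let $\mathcal{X}$ be a finite set and $P$ a probability mass function (pmf) on $\mathcal{X}$. For $n\ge 1$ let $\mathcal{Q}_n$ be a set of pmfs on $\mathcal{X}^n$, and put $\mathcal{Q}:=\mathcal{Q}_1$. Write $P^{\times n}(x^n)=\prod_i P(x_i)$. **Definitions.** For pmfs $P,Q$ on a finite set and $s>0$, $s\neq 1$, let $g_s(P\|Q)=\sum_{x:P(x)>0}P(x)^sQ(x)^{1-s}\in[0,\infty]$ (it is $+\infty$ if $s>1$ and $Q(x)=0<P(x)$ for some $x$) and $D_s(P\|Q)=\frac{1}{s-1}\log g_s(P\|Q)$. Let $D_1$ be the relative entropy. For a set $\mathcal{S}$ of pmfs let $D_s(P\|\mathcal{S})=\inf_{Q\in\mathcal{S}}D_s(P\|Q)$. For $\mu>0$ let $\hat\alpha(\mu;P\|\mathcal{S})$ be the minimum of $\sum_x P(x)(1-T(x))$ over all functions $T$ with values in $[0,1]$ such that $\sup_{Q\in\mathcal{S}}\sum_x Q(x)T(x)\le\mu$. The strong converse exponent at rate $R\ge 0$ is $$\mathrm{sc}_R(\mathbb{H})=\limsup_{n\to\infty}-\frac1n\log\Big(1-\hat\alpha\big(e^{-nR};P^{\times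 n}\big\|\mathcal{Q}_n\big)\Big).$$ A function on $\mathcal{X}^n$ is called symmetric if it is invariant under all permutations of the $n$ coordinates, and $\mathcal{Q}_n^{\rm sym}$ is the set of symmetric elements of $\mathcal{Q}_n$. **Assumptions.** Let $1<b\le\infty$. Assume that some $Q\in\mathcal{Q}$ has a support containing that of $P$, and that: 1. (products) $Q^{\times n}\in\mathcal{Q}_n$ for all $Q\in\mathcal{Q}$ and $n\ge1$; 2. (additivity) $D_s(P^{\times n}\|\mathcal{Q}_n)\ge n\,D_s(P\|\mathcal{Q})$ for all $s\in[1,b)$ and $n\ge1$; 3. (universal distributions) there are symmetric pmfs $U^n$ on $\mathcal{X}^n$ and a polynomial $v$ such that, for all $n\ge1$, $Q(x^n)\le v(n)\,U^n(x^n)$ for all $Q\in\mathcal{Q}_n^{\rm sym}$ and $x^n\in\mathcal{X}^n$, and $D_s(P^{\times n}\|U^n)\ge D_s(P^{\times n}\|\mathcal{Q}_n)$ for all $s\in[1,b)$; moreover, the average over all coordinate permutations of any element of $\mathcal{Q}_n$ lies in $\mathcal{Q}_n^{\rm sym}$; 4. (convex parametrization) $\mathcal{Q}=\{Q_\theta:\theta\in\Theta\}$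 for a compact convex subset $\Theta$ of a finite-dimensional real vector space and a $C^2$ map $\theta\mapsto Q_\theta$, such that $\theta\mapsto g_s(P\|Q_\theta)$ is convex for $s\in(1,b)$ and, for every $s\in[1,b)$, the minimizer of $\theta\mapsto D_s(P\|Q_\theta)$ over $\Theta$ is unique and lies in the (relative) interior of $\Theta$. **Conclusion.** For every $R\ge0$, $$\mathrm{sc}_R(\mathbb{H})\ \ge\ \sup_{s\in(1,b)}\Big\{\frac{s-1}{s}\big(R-D_s(P\|\mathcal{Q})\big)\Big\}.$$ Moreover, $\phi(s):=(s-1)D_s(P\|\mathcal{Q})$ is differentiable on $(1,b)$, the critical rate $R_b:=\lim_{s\uparrow b}\big(s\phi'(s)-\phi(s)\big)$ exists in the extended reals, and equality holds in the above inequality for every $R\ge0$ with $R\le R_b$. -/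

import Mathlib

open Filter Topology

noncomputable section

namespace CompositeTesting

/-- The i.i.d. distribution `P^{×n}` on `X^n`. -/
def iid {X : Type*} (P : X → ℝ) (n : ℕ) : (Fin n → X) → ℝ :=
  fun x => ∏ i, P (x i)

/-- A sequence of hypothesis testing problems with composite alternative hypothesis: a probability
mass function `P` on the finite set `X` and, for every `n`, a set `Q n` of probability mass
functions on `X^n`. -/
structure Problem (X : Type*) [Fintype X] where
  /-- the null hypothesis -/
  P : X → ℝ
  P_mem : P ∈ stdSimplex ℝ X
  /-- the alternative hypotheses -/
  Q : (n : ℕ) → Set ((Fin n → X) → ℝ)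
  Q_subset : ∀ n, Q n ⊆ stdSimplex ℝ (Fin n → X)

/-! ### Tests and the strong converse exponent -/

section Tests

variable {Y : Type*} [Fintype Y]

/-- Type-I error probability of the test `T`. -/
def typeI (T : Y → ℝ) (P : Y → ℝ) : ℝ := ∑ y, P y * (1 - T y)

/-- Type-II error probability of the test `T`: the supremum over the alternative. -/
def typeII (T : Y → ℝ) (S : Set (Y → ℝ)) : ℝ :=
  sSup ((fun q : Y → ℝ => ∑ y, q y * T y) '' S)

/-- Minimal type-I error among the (randomized) tests `T : Y → [0,1]` with type-II error at
most `μ`. -/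
def alphaHat (μ : ℝ) (P : Y → ℝ) (S : Set (Y → ℝ)) : ℝ :=
  sInf ((fun T : Y → ℝ => typeI T P) ''
    {T | (∀ y, T y ∈ Set.Icc (0 : ℝ) 1) ∧ typeII T S ≤ μ})

/-! ### Rényi divergences -/

/-- `g_s(P‖Q) = ∑_{P(y) > 0} P(y)^s Q(y)^{1-s}`, with values in `[0,∞]`. By the conventions of
`ℝ≥0∞`, it is `∞` if `s > 1` and `Q(y) = 0 < P(y)` for some `y`. -/
def gRenyi (s : ℝ) (P Q : Y → ℝ) : ENNReal :=
  open Classical in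
  ∑ y ∈ Finset.univ.filter (fun y => 0 < P y),
    ENNReal.ofReal (P y) ^ s * ENNReal.ofReal (Q y) ^ (1 - s)

/-- Relative entropy, `+∞` if the support of `P` is not contained in that of `Q`. -/
def relEntropy (P Q : Y → ℝ) : EReal :=
  open Classical in
  if ∀ y, Q y = 0 → P y = 0 then
    ((∑ y, P y * (Real.log (P y) - Real.log (Q y)) : ℝ) : EReal)
  else ⊤

/-- Rényi divergence `D_s(P‖Q)` of order `s > 0`; at `s = 1` it is the relative entropy. -/
def renyi (s : ℝ) (P Q : Y → ℝ) : EReal :=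
  if s = 1 then relEntropy P Q
  else ENNReal.log (gRenyi s P Q) / ((s - 1 : ℝ) : EReal)

/-- Rényi divergence `D_s(P‖S)` with regards to a set. -/
def renyiSet (s : ℝ) (P : Y → ℝ) (S : Set (Y → ℝ)) : EReal :=
  ⨅ q ∈ S, renyi s P q

end Tests

/-! ### Symmetrization -/

/-- Permutation invariant functions on `X^n`. -/
def PermInvariant {X : Type*} {n : ℕ} (q : (Fin n → X) → ℝ) : Prop :=
  ∀ (π : Equiv.Perm (Fin n)) (x : Fin n → X), q (fun i => x (π i)) = q x

/-- The average of `q` over all permutations of the coordinates. -/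
def symmetrize {X : Type*} {n : ℕ} (q : (Fin n → X) → ℝ) : (Fin n → X) → ℝ :=
  fun x => (1 / (n.factorial : ℝ)) * ∑ π : Equiv.Perm (Fin n), q (fun i => x (π i))

/-- The set `[1, b)` of orders, where `1 < b ≤ ∞`. -/
def orders (b : EReal) : Set ℝ := {s | 1 ≤ s ∧ (s : EReal) < b}

/-- The filter `s ↑ b` on the real line, for an extended real number `b`. -/
def upTo (b : EReal) : Filter ℝ :=
  comap (fun s : ℝ => (s : EReal)) (𝓝[<] b)

namespace Problem

variable {X : Type*} [Fintype X] (H : Problem X)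

/-- The strong converse exponent
`limsup_n - (1/n) log (1 - α̂(exp(-nR); P^{×n} ‖ Q_n))`, in the extended reals. -/
def sc (R : ℝ) : EReal :=
  limsup (fun n : ℕ =>
    -(ENNReal.log (ENNReal.ofReal
        (1 - alphaHat (Real.exp (-((n : ℝ) * R))) (iid H.P n) (H.Q n))) / ((n : ℝ) : EReal)))
    atTop

/-- The base set `𝒬 = 𝒬_1`, seen as a set of distributions on `X = X^1`. -/
def base : Set (X → ℝ) := {q | (fun x : Fin 1 → X => q (x 0)) ∈ H.Q 1}

/-- The elements of `𝒬_n` that are permutation invariant. -/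
def Qsym (n : ℕ) : Set ((Fin n → X) → ℝ) := {q | q ∈ H.Q n ∧ PermInvariant q}

/-- Product distributions: `𝒬_n` contains `q^{×n}` for every `q ∈ 𝒬`. -/
def ProductDistributions : Prop :=
  ∀ n : ℕ, 1 ≤ n → ∀ q ∈ H.base, iid q n ∈ H.Q n

/-- Additivity, for orders in `[1, b)`. -/
def AdditivityOn (b : EReal) : Prop :=
  ∀ s ∈ orders b, ∀ n : ℕ, 1 ≤ n →
    ((n : ℝ) : EReal) * renyiSet s H.P H.base ≤ renyiSet s (iid H.P n) (H.Q n)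

/-- Existence of universal distributions, for orders in `[1, b)`, and closedness of the
alternatives under symmetrization. -/
def UniversalOn (b : EReal) : Prop :=
  (∃ (U : (n : ℕ) → (Fin n → X) → ℝ) (v : Polynomial ℝ), ∀ n : ℕ, 1 ≤ n →
    U n ∈ stdSimplex ℝ (Fin n → X) ∧ PermInvariant (U n) ∧
    (∀ q ∈ H.Qsym n, ∀ x, q x ≤ v.eval (n : ℝ) * U n x) ∧
    (∀ s ∈ orders b, renyiSet s (iid H.P n) (H.Q n) ≤ renyi s (iid H.P n) (U n))) ∧
  (∀ n : ℕ, 1 ≤ n → ∀ q ∈ H.Q n, symmetrize q ∈ H.Qsym n)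

/-- Convex parametrization, for orders in `[1, b)`: a compact convex set `Θ` in a
finite-dimensional space and a `C²` map `θ ↦ q θ` from `Θ` onto `𝒬` such that `θ ↦ g_s(P‖q θ)` is
convex (as a `[0,∞]`-valued function) for `s ∈ (1,b)` and the minimizer of `θ ↦ D_s(P‖q θ)` is
unique and in the (relative) interior of `Θ` for `s ∈ [1,b)`. -/
def ConvexParametrizationOn (b : EReal) : Prop :=
  ∃ (d : ℕ) (Θ : Set (EuclideanSpace ℝ (Fin d))) (q : EuclideanSpace ℝ (Fin d) → X → ℝ),
    IsCompact Θ ∧ Convex ℝ Θ ∧ ContDiffOn ℝ 2 q Θ ∧ q '' Θ = H.base ∧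
    (∀ s : ℝ, 1 < s → (s : EReal) < b →
      ∀ θ₁ ∈ Θ, ∀ θ₂ ∈ Θ, ∀ t₁ t₂ : ℝ, 0 ≤ t₁ → 0 ≤ t₂ → t₁ + t₂ = 1 →
        gRenyi s H.P (q (t₁ • θ₁ + t₂ • θ₂)) ≤
          ENNReal.ofReal t₁ * gRenyi s H.P (q θ₁) + ENNReal.ofReal t₂ * gRenyi s H.P (q θ₂)) ∧
    (∀ s ∈ orders b, ∃ θ₀ ∈ intrinsicInterior ℝ Θ,
      IsMinOn (fun θ => renyi s H.P (q θ)) Θ θ₀ ∧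
      ∀ θ ∈ Θ, IsMinOn (fun θ => renyi s H.P (q θ)) Θ θ → θ = θ₀)

/-- `φ(s) = (s-1) D_s(P‖𝒬)`, as a real function (used where `D_s(P‖𝒬)` is finite). -/
def phi (s : ℝ) : ℝ := (s - 1) * (renyiSet s H.P H.base).toReal

/-- The function `s ↦ s φ'(s) - φ(s)`, seen in the extended reals. -/
def psi (s : ℝ) : EReal := ((s * deriv H.phi s - H.phi s : ℝ) : EReal)

/-- The critical rate `R_b = lim_{s ↑ b} (s φ'(s) - φ(s))`. -/
def criticalRate (b : EReal) : EReal := limUnder (upTo b) H.psi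

/-- `sup_{s ∈ (1,b)} ((s-1)/s) (R - D_s(P‖𝒬))`. -/
def scBound (b : EReal) (R : ℝ) : EReal :=
  ⨆ (s : ℝ) (_ : 1 < s ∧ (s : EReal) < b),
    (((s - 1) / s : ℝ) : EReal) * ((R : EReal) - renyiSet s H.P H.base)

end Problem

end CompositeTesting

end

namespace CompositeTesting

/-! Write `φ(s) = (s-1) D_s(P‖𝒬)`, the least value of `log g_s(P‖q)` over the base set; the
parametrization makes it an attained minimum. The lower bound on the exponent is Young's inequality
(`sum_mul_test_le`) tested against `q^{×n}`, with `q` optimal for the given order. For the converse,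
`U^n` replaces the whole family `𝒬_n`. Additivity and domination squeeze `log g_s(P^{×n}‖U^n)`
between `nφ(s)` and `nφ(s) + (s-1) log v(n)`, and a symmetric test has type-II error at most `v(n)`
times its mass under `U^n`. Two consequences follow. First, `φ` is a limit of convex functions of
`s`, hence convex; it touches the smooth function `log g_·(P‖q)` from below at each `s`, hence is
differentiable. Second, as in the Gärtner–Ellis theorem, the tilted law proportional to `(P^{×n})^s
(U^n)^{1-s}` concentrates where the log-likelihood ratio is near `nφ'(s)`; accepting that window
gives rate `sφ'(s) - φ(s)` at exponent `(s-1)φ'(s) - φ(s)` (`sc_le_of_le`). Finally `((s-1)R -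
φ(s))/s` has derivative `(R - (sφ'(s) - φ(s)))/s²`, so the two bounds meet at a stationary order. If
`R` lies below all the rates, orders near `1` give exponent `0`; if `R = R_b`, rates approaching
`R_b` suffice. -/

lemma pos_of_dominated {Y : Type*} {P Q : Y → ℝ} (hQ : ∀ y, 0 ≤ Q y)
    (hPQ : ∀ y, Q y = 0 → P y = 0) {y : Y} (hy : 0 < P y) : 0 < Q y :=
  lt_of_le_of_ne (hQ y) fun h => hy.ne' (hPQ y h.symm)

lemma iid_dominated {X : Type*} {P Q : X → ℝ} (hPQ : ∀ x, Q x = 0 → P x = 0) (n : ℕ) :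
    ∀ x, iid Q n x = 0 → iid P n x = 0 := by
  intro x hx
  obtain ⟨i, hi, h0⟩ := Finset.prod_eq_zero_iff.1 hx
  exact Finset.prod_eq_zero hi (hPQ _ h0)

lemma permInvariant_iid {X : Type*} (P : X → ℝ) (n : ℕ) : PermInvariant (iid P n) := fun π x =>
  Equiv.prod_comp π fun i => P (x i)

/-! ### Rényi divergences and tests for a pair of distributions. -/

section SingleLetter

variable {Y : Type*} [Fintype Y]

/-- `∑ P exp((s-1) log(P/Q))`, the real-valued form of `g_s(P‖Q)` for `Q` dominating `P`. -/
noncomputable def tiltedSum (s : ℝ) (P Q : Y → ℝ) : ℝ :=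
  ∑ y, P y * Real.exp ((s - 1) * (Real.log (P y) - Real.log (Q y)))

/-- The logarithm of `tiltedSum`. -/
noncomputable def logTilted (s : ℝ) (P Q : Y → ℝ) : ℝ := Real.log (tiltedSum s P Q)

lemma exists_pos_of_mem_stdSimplex {P : Y → ℝ} (hP : P ∈ stdSimplex ℝ Y) : ∃ y, 0 < P y := by
  by_contra! h
  have h1 : ∑ y, P y ≤ 0 := Finset.sum_nonpos fun y _ => h y
  rw [hP.2] at h1
  linarith

lemma tiltedSum_pos {P : Y → ℝ} (hP : P ∈ stdSimplex ℝ Y) (s : ℝ) (Q : Y → ℝ) :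
    0 < tiltedSum s P Q := by
  obtain ⟨y, hy⟩ := exists_pos_of_mem_stdSimplex hP
  exact Finset.sum_pos' (fun z _ => mul_nonneg (hP.1 z) (Real.exp_pos _).le)
    ⟨y, Finset.mem_univ _, mul_pos hy (Real.exp_pos _)⟩

lemma exp_logTilted {P : Y → ℝ} (hP : P ∈ stdSimplex ℝ Y) (s : ℝ) (Q : Y → ℝ) :
    Real.exp (logTilted s P Q) = tiltedSum s P Q :=
  Real.exp_log (tiltedSum_pos hP s Q)

lemma logTilted_one {P : Y → ℝ} (hP : P ∈ stdSimplex ℝ Y) (Q : Y → ℝ) :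
    logTilted 1 P Q = 0 := by
  simp [logTilted, tiltedSum, hP.2]

lemma gRenyi_eq_ofReal {P Q : Y → ℝ} (hP : ∀ y, 0 ≤ P y) (hQ : ∀ y, 0 ≤ Q y)
    (hPQ : ∀ y, Q y = 0 → P y = 0) (s : ℝ) :
    gRenyi s P Q = ENNReal.ofReal (tiltedSum s P Q) := by
  classical
  unfold gRenyi tiltedSum
  rw [ENNReal.ofReal_sum_of_nonneg fun y _ => mul_nonneg (hP y) (Real.exp_pos _).le,
    Finset.sum_filter]
  refine Finset.sum_congr rfl fun y _ => ?_
  split_ifs with hy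
  · have hq := pos_of_dominated hQ hPQ hy
    rw [ENNReal.ofReal_rpow_of_pos hy, ENNReal.ofReal_rpow_of_pos hq,
      ← ENNReal.ofReal_mul (by positivity), Real.rpow_def_of_pos hy, Real.rpow_def_of_pos hq,
      ← Real.exp_add]
    nth_rewrite 2 [← Real.exp_log hy]
    rw [← Real.exp_add]
    ring_nf
  · have : P y = 0 := le_antisymm (not_lt.1 hy) (hP y)
    simp [this]

lemma renyi_eq_logTilted {P Q : Y → ℝ} (hP : P ∈ stdSimplex ℝ Y) (hQ : ∀ y, 0 ≤ Q y)
    (hPQ : ∀ y, Q y = 0 → P y = 0) {s : ℝ} (hs : 1 < s) :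
    renyi s P Q = ((logTilted s P Q / (s - 1) : ℝ) : EReal) := by
  rw [renyi, if_neg hs.ne', gRenyi_eq_ofReal hP.1 hQ hPQ,
    ENNReal.log_ofReal_of_pos (tiltedSum_pos hP s Q), ← EReal.coe_div]
  rfl

lemma renyi_eq_top {P Q : Y → ℝ} (hP : ∀ y, 0 ≤ P y) (hPQ : ¬ ∀ y, Q y = 0 → P y = 0) {s : ℝ}
    (hs : 1 < s) : renyi s P Q = ⊤ := by
  classical
  push Not at hPQ
  obtain ⟨y, hy, hPy⟩ := hPQ
  have hpos : 0 < P y := lt_of_le_of_ne (hP y) (Ne.symm hPy)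
  have htop : gRenyi s P Q = ⊤ := by
    unfold gRenyi
    refine ENNReal.sum_eq_top.2 ⟨y, by simpa using hpos, ?_⟩
    rw [hy, ENNReal.ofReal_zero, ENNReal.zero_rpow_of_neg (by linarith), ENNReal.mul_top]
    rw [ENNReal.ofReal_rpow_of_pos hpos]
    simpa using Real.rpow_pos_of_pos hpos s
  rw [renyi, if_neg hs.ne', htop, ENNReal.log_top]
  exact EReal.top_div_of_pos_ne_top (by exact_mod_cast sub_pos.2 hs) (EReal.coe_ne_top _)

/-- Two tangent-line bounds with `z = log(P/Q)`: `P exp((s-1)z) ≥ P + (s-1)Pz` and `Pz ≥ P - Q`. The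
resulting lower bound sums to `1`. -/
lemma logTilted_nonneg {P Q : Y → ℝ} (hP : P ∈ stdSimplex ℝ Y) (hQ : Q ∈ stdSimplex ℝ Y)
    (hPQ : ∀ y, Q y = 0 → P y = 0) {s : ℝ} (hs : 1 ≤ s) : 0 ≤ logTilted s P Q := by
  refine Real.log_nonneg ?_
  have key : ∀ y, P y + (s - 1) * (P y - Q y) ≤
      P y * Real.exp ((s - 1) * (Real.log (P y) - Real.log (Q y))) := by
    intro y
    rcases (hP.1 y).eq_or_lt with h | h
    · rw [← h]
      nlinarith [hQ.1 y]
    · have hq := pos_of_dominated hQ.1 hPQ h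
      have h1 := Real.add_one_le_exp ((s - 1) * (Real.log (P y) - Real.log (Q y)))
      have h2 := Real.add_one_le_exp (-(Real.log (P y) - Real.log (Q y)))
      have h3 : P y * Real.exp (-(Real.log (P y) - Real.log (Q y))) = Q y := by
        rw [neg_sub, Real.exp_sub, Real.exp_log h, Real.exp_log hq]
        field_simp
      have h4 : P y - Q y ≤ P y * (Real.log (P y) - Real.log (Q y)) := by
        nlinarith
      nlinarith [mul_le_mul_of_nonneg_left h1 h.le,
        mul_le_mul_of_nonneg_left h4 (sub_nonneg.2 hs)]
  calc (1 : ℝ) = ∑ y, (P y + (s - 1) * (P y - Q y)) := by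
        rw [Finset.sum_add_distrib, ← Finset.mul_sum, Finset.sum_sub_distrib, hP.2, hQ.2]
        ring
    _ ≤ _ := Finset.sum_le_sum fun y _ => key y

/-- Hölder's inequality: once both sums are normalized to `1`, it is convexity of `exp` term by
term. -/
lemma convexOn_logTilted {P : Y → ℝ} (hP : P ∈ stdSimplex ℝ Y) (Q : Y → ℝ) :
    ConvexOn ℝ Set.univ fun s => logTilted s P Q := by
  refine ⟨convex_univ, fun s _ t _ a c ha hc hac => ?_⟩
  simp only [smul_eq_mul]
  rw [← Real.exp_le_exp, exp_logTilted hP]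
  set A := logTilted s P Q with hA
  set B := logTilted t P Q with hB
  have hA' : tiltedSum s P Q * Real.exp (-A) = 1 := by
    rw [← exp_logTilted hP, ← hA, ← Real.exp_add]; simp
  have hB' : tiltedSum t P Q * Real.exp (-B) = 1 := by
    rw [← exp_logTilted hP, ← hB, ← Real.exp_add]; simp
  have key : tiltedSum (a * s + c * t) P Q * Real.exp (-(a * A + c * B)) ≤ 1 := by
    have : (1 : ℝ) = a * (tiltedSum s P Q * Real.exp (-A))
        + c * (tiltedSum t P Q * Real.exp (-B)) := by rw [hA', hB']; linarith
    rw [this]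
    unfold tiltedSum
    rw [Finset.sum_mul, Finset.sum_mul, Finset.sum_mul, Finset.mul_sum, Finset.mul_sum,
      ← Finset.sum_add_distrib]
    refine Finset.sum_le_sum fun y _ => ?_
    set z := Real.log (P y) - Real.log (Q y)
    have h := convexOn_exp.2 (Set.mem_univ ((s - 1) * z - A)) (Set.mem_univ ((t - 1) * z - B))
      ha hc hac
    simp only [smul_eq_mul] at h
    have e : a * ((s - 1) * z - A) + c * ((t - 1) * z - B)
        = (a * s + c * t - 1) * z + -(a * A + c * B) := by
      linear_combination (-z) * hac
    rw [e, Real.exp_add, sub_eq_add_neg _ A, sub_eq_add_neg _ B, Real.exp_add,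
      Real.exp_add ((t - 1) * z)] at h
    have := mul_le_mul_of_nonneg_left h (hP.1 y)
    linarith
  have h1 := mul_le_mul_of_nonneg_right key (Real.exp_pos (a * A + c * B)).le
  rwa [mul_assoc, ← Real.exp_add, neg_add_cancel, Real.exp_zero, mul_one, one_mul] at h1

lemma differentiable_logTilted {P : Y → ℝ} (hP : P ∈ stdSimplex ℝ Y) (Q : Y → ℝ) :
    Differentiable ℝ fun s => logTilted s P Q := by
  have h : Differentiable ℝ fun s => tiltedSum s P Q := by
    unfold tiltedSum
    fun_prop
  exact fun s => (h s).log (tiltedSum_pos hP s Q).ne'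

/-- Domination up to a factor `v` changes `log g_s` by at most `(s-1) log v`. -/
lemma logTilted_le_of_le_mul {P Q U : Y → ℝ} (hP : P ∈ stdSimplex ℝ Y) (hQ : ∀ y, 0 ≤ Q y)
    (hPQ : ∀ y, Q y = 0 → P y = 0) {v : ℝ} (hv : 0 < v)
    (hQU : ∀ y, Q y ≤ v * U y)
    {s : ℝ} (hs : 1 ≤ s) : logTilted s P U ≤ logTilted s P Q + (s - 1) * Real.log v := by
  rw [← Real.exp_le_exp, Real.exp_add, exp_logTilted hP, exp_logTilted hP]
  unfold tiltedSum
  rw [Finset.sum_mul]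
  refine Finset.sum_le_sum fun y _ => ?_
  rcases (hP.1 y).eq_or_lt with h | h
  · simp [← h]
  · have hq := pos_of_dominated hQ hPQ h
    have hu : 0 < U y := by
      have := hq.trans_le (hQU y)
      exact pos_of_mul_pos_right this hv.le
    have hlog : Real.log (Q y) ≤ Real.log v + Real.log (U y) := by
      rw [← Real.log_mul hv.ne' hu.ne']
      exact Real.log_le_log hq (hQU y)
    rw [mul_assoc, ← Real.exp_add]
    refine mul_le_mul_of_nonneg_left (Real.exp_le_exp.2 ?_) h.le
    nlinarith [mul_le_mul_of_nonneg_left hlog (sub_nonneg.2 hs)]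

/-- The data processing bound for a test with type-II error `exp(-ρ)`. -/
lemma sum_mul_test_le {P Q T : Y → ℝ} (hP : P ∈ stdSimplex ℝ Y) (hQ : ∀ y, 0 ≤ Q y)
    (hPQ : ∀ y, Q y = 0 → P y = 0) (hT : ∀ y, T y ∈ Set.Icc (0 : ℝ) 1) {s ρ : ℝ} (hs : 1 < s)
    (hQT : ∑ y, Q y * T y ≤ Real.exp (-ρ)) :
    ∑ y, P y * T y ≤ Real.exp (-(((s - 1) * ρ - logTilted s P Q) / s)) := by
  have hs0 : 0 < s := by linarith
  set γ := logTilted s P Q with hγ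
  -- This threshold gives the two terms of Young's inequality the same exponent after summation.
  set k := (γ + ρ) / s with hk
  have hks : k * s = γ + ρ := by rw [hk]; field_simp
  have key : ∀ y, P y * T y ≤ 1 / s * Real.exp (-((s - 1) * k)) *
      (P y * Real.exp ((s - 1) * (Real.log (P y) - Real.log (Q y)))) +
      (s - 1) / s * Real.exp k * (Q y * T y) := by
    intro y
    rcases (hP.1 y).eq_or_lt with h | h
    · rw [← h]
      have h0 := mul_nonneg (hQ y) (hT y).1
      have h1 : 0 ≤ (s - 1) / s * Real.exp k :=
        mul_nonneg (div_nonneg (by linarith) hs0.le) (Real.exp_pos _).le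
      simp only [zero_mul, mul_zero, zero_add]
      exact mul_nonneg h1 h0
    · have hq := pos_of_dominated hQ hPQ h
      set z := Real.log (P y) - Real.log (Q y) with hz
      have hPz : P y = Q y * Real.exp z := by
        rw [hz, Real.exp_sub, Real.exp_log h, Real.exp_log hq]; field_simp
      have hc := convexOn_exp.2 (Set.mem_univ (s * z - (s - 1) * k)) (Set.mem_univ k)
        (show 0 ≤ 1 / s by positivity)
        (show 0 ≤ (s - 1) / s from div_nonneg (by linarith) hs0.le) (by field_simp; ring)
      simp only [smul_eq_mul] at hc
      have e : 1 / s * (s * z - (s - 1) * k) + (s - 1) / s * k = z := by field_simp; ring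
      have e2 : s * z - (s - 1) * k = z + ((s - 1) * z + -((s - 1) * k)) := by ring
      rw [e, e2, Real.exp_add z, Real.exp_add ((s - 1) * z)] at hc
      have h1 := mul_le_mul_of_nonneg_left hc (mul_nonneg hq.le (hT y).1)
      have h2 : 0 ≤ 1 / s * Real.exp (-((s - 1) * k)) * (P y * Real.exp ((s - 1) * z)) := by
        positivity
      have h3 := mul_le_mul_of_nonneg_left (hT y).2 h2
      rw [hPz] at h3 ⊢
      nlinarith
  calc ∑ y, P y * T y ≤ 1 / s * Real.exp (-((s - 1) * k)) * tiltedSum s P Q +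
        (s - 1) / s * Real.exp k * ∑ y, Q y * T y := by
        unfold tiltedSum
        rw [Finset.mul_sum, Finset.mul_sum, ← Finset.sum_add_distrib]
        exact Finset.sum_le_sum fun y _ => key y
    _ ≤ 1 / s * Real.exp (-((s - 1) * k)) * Real.exp γ +
        (s - 1) / s * Real.exp k * Real.exp (-ρ) := by
        rw [← exp_logTilted hP]
        gcongr
    _ = _ := by
        rw [mul_assoc, mul_assoc, ← Real.exp_add, ← Real.exp_add]
        have e1 : -((s - 1) * k) + γ = -(((s - 1) * ρ - γ) / s) := by
          rw [hk]; field_simp; ring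
        have e2 : k + -ρ = -(((s - 1) * ρ - γ) / s) := by
          rw [hk]; field_simp; ring
        rw [e1, e2, ← add_mul]
        have : 1 / s + (s - 1) / s = 1 := by field_simp; ring
        rw [this, one_mul]

/-- Concentration of the tilted measure `P exp((s-1)z)`, `z = log(P/U)`, on a window of
log-likelihood ratios: mass of the window under `P`, and under `U`. -/
lemma window_bounds {P U : Y → ℝ} (hP : P ∈ stdSimplex ℝ Y) (hU : ∀ y, 0 ≤ U y)
    (hPU : ∀ y, U y = 0 → P y = 0) {s h lo hi : ℝ} (hs : 1 < s) (hh : 0 < h)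
    (hup : logTilted (s + h) P U - logTilted s P U - h * hi ≤ -Real.log 4)
    (hlow : logTilted (s - h) P U - logTilted s P U + h * lo ≤ -Real.log 4)
    (E : Y → Prop) [DecidablePred E]
    (hE : ∀ y, E y ↔ 0 < P y ∧ lo ≤ Real.log (P y) - Real.log (U y) ∧
      Real.log (P y) - Real.log (U y) ≤ hi) :
    Real.exp (logTilted s P U - (s - 1) * hi) / 2 ≤ ∑ y, P y * (if E y then 1 else 0) ∧
      ∑ y, U y * (if E y then 1 else 0) ≤ Real.exp (logTilted s P U - s * lo) := by
  set z : Y → ℝ := fun y => Real.log (P y) - Real.log (U y) with hz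
  set M := tiltedSum s P U with hM
  have hMpos : 0 < M := tiltedSum_pos hP s U
  have hlogM : Real.exp (logTilted s P U) = M := exp_logTilted hP s U
  have h4 : Real.exp (-Real.log 4) = 1 / 4 := by
    rw [Real.exp_neg, Real.exp_log (by norm_num)]; norm_num
  have tail1 : tiltedSum (s + h) P U * Real.exp (-(h * hi)) ≤ M / 4 := by
    have h1 := Real.exp_le_exp.2
      (show logTilted (s + h) P U + -(h * hi) ≤ logTilted s P U + -Real.log 4 by linarith)
    rw [Real.exp_add, Real.exp_add, exp_logTilted hP, hlogM, h4] at h1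
    linarith
  have tail2 : tiltedSum (s - h) P U * Real.exp (h * lo) ≤ M / 4 := by
    have h1 := Real.exp_le_exp.2
      (show logTilted (s - h) P U + h * lo ≤ logTilted s P U + -Real.log 4 by linarith)
    rw [Real.exp_add, Real.exp_add, exp_logTilted hP, hlogM, h4] at h1
    linarith
  set W : Y → ℝ := fun y => P y * Real.exp ((s - 1) * z y) with hW
  have hW0 : ∀ y, 0 ≤ W y := fun y => mul_nonneg (hP.1 y) (Real.exp_pos _).le
  -- Exponential Markov: above `hi` the factor `exp(h(z - hi))` is at least `1`, below `lo` so is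
  -- `exp(h(lo - z))`. Each tail costs at most `M/4`, leaving the window half of the tilted mass.
  have hsplit : ∀ y, W y ≤ W y * (if E y then 1 else 0) +
      P y * Real.exp ((s + h - 1) * z y) * Real.exp (-(h * hi)) +
      P y * Real.exp ((s - h - 1) * z y) * Real.exp (h * lo) := by
    intro y
    have n1 : 0 ≤ P y * Real.exp ((s + h - 1) * z y) * Real.exp (-(h * hi)) :=
      mul_nonneg (mul_nonneg (hP.1 y) (Real.exp_pos _).le) (Real.exp_pos _).le
    have n2 : 0 ≤ P y * Real.exp ((s - h - 1) * z y) * Real.exp (h * lo) :=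
      mul_nonneg (mul_nonneg (hP.1 y) (Real.exp_pos _).le) (Real.exp_pos _).le
    by_cases hEy : E y
    · rw [if_pos hEy]; linarith
    · rw [if_neg hEy]
      rcases (hP.1 y).eq_or_lt with h0 | h0
      · have : W y = 0 := by simp [hW, ← h0]
        rw [this] at *; linarith
      · have hor : z y < lo ∨ hi < z y := by
          by_contra! hcon
          exact hEy ((hE y).2 ⟨h0, hcon.1, hcon.2⟩)
        rcases hor with hl | hl
        · have : W y ≤ P y * Real.exp ((s - h - 1) * z y) * Real.exp (h * lo) := by
            rw [mul_assoc, ← Real.exp_add]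
            refine mul_le_mul_of_nonneg_left (Real.exp_le_exp.2 ?_) h0.le
            nlinarith
          linarith
        · have : W y ≤ P y * Real.exp ((s + h - 1) * z y) * Real.exp (-(h * hi)) := by
            rw [mul_assoc, ← Real.exp_add]
            refine mul_le_mul_of_nonneg_left (Real.exp_le_exp.2 ?_) h0.le
            nlinarith
          linarith
  have hmass : M / 2 ≤ ∑ y, W y * (if E y then 1 else 0) := by
    have h1 := Finset.sum_le_sum fun y (_ : y ∈ Finset.univ) => hsplit y
    rw [Finset.sum_add_distrib, Finset.sum_add_distrib, ← Finset.sum_mul, ← Finset.sum_mul] at h1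
    change M ≤ _ + tiltedSum (s + h) P U * _ + tiltedSum (s - h) P U * _ at h1
    linarith
  constructor
  · calc Real.exp (logTilted s P U - (s - 1) * hi) / 2
        = M / 2 * Real.exp (-((s - 1) * hi)) := by
          rw [sub_eq_add_neg, Real.exp_add, hlogM]; ring
      _ ≤ (∑ y, W y * (if E y then 1 else 0)) * Real.exp (-((s - 1) * hi)) := by gcongr
      _ ≤ _ := by
          rw [Finset.sum_mul]
          refine Finset.sum_le_sum fun y _ => ?_
          split_ifs with hEy
          · obtain ⟨h0, -, h2⟩ := (hE y).1 hEy
            rw [mul_one, mul_one, hW]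
            simp only
            rw [mul_assoc, ← Real.exp_add]
            have : Real.exp ((s - 1) * z y + -((s - 1) * hi)) ≤ 1 := by
              rw [Real.exp_le_one_iff]
              have : z y ≤ hi := h2
              nlinarith
            nlinarith
          · simp
  · calc ∑ y, U y * (if E y then 1 else 0)
        ≤ ∑ y, W y * Real.exp (-(s * lo)) := by
          refine Finset.sum_le_sum fun y _ => ?_
          split_ifs with hEy
          · obtain ⟨h0, h1, -⟩ := (hE y).1 hEy
            have hu := pos_of_dominated hU hPU h0
            have hUz : U y = P y * Real.exp (-z y) := by
              simp only [hz]
              rw [neg_sub, Real.exp_sub, Real.exp_log h0, Real.exp_log hu]; field_simp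
            rw [mul_one, hUz]
            simp only [hW]
            rw [mul_assoc, ← Real.exp_add]
            refine mul_le_mul_of_nonneg_left (Real.exp_le_exp.2 ?_) h0.le
            have : lo ≤ z y := h1
            nlinarith
          · simpa using mul_nonneg (hW0 y) (Real.exp_pos (-(s * lo))).le
      _ = _ := by
          rw [← Finset.sum_mul, sub_eq_add_neg, Real.exp_add, hlogM]
          rfl

end SingleLetter

/-! ### Product distributions and symmetrization. -/

section Products

variable {X : Type*} [Fintype X]

lemma iid_mem_stdSimplex {P : X → ℝ} (hP : P ∈ stdSimplex ℝ X) (n : ℕ) :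
    iid P n ∈ stdSimplex ℝ (Fin n → X) := by
  refine ⟨fun x => Finset.prod_nonneg fun i _ => hP.1 _, ?_⟩
  simp only [iid]
  rw [← Fintype.sum_pow, hP.2, one_pow]

lemma tiltedSum_iid {P Q : X → ℝ} (hPQ : ∀ x, Q x = 0 → P x = 0) (s : ℝ) (n : ℕ) :
    tiltedSum s (iid P n) (iid Q n) = tiltedSum s P Q ^ n := by
  unfold tiltedSum
  rw [Fintype.sum_pow]
  refine Finset.sum_congr rfl fun x _ => ?_
  -- The logarithm of the product splits only if no factor vanishes; otherwise both sides are zero.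
  by_cases h : ∃ i, P (x i) = 0
  · obtain ⟨i, hi⟩ := h
    have h1 : iid P n x = 0 := Finset.prod_eq_zero (Finset.mem_univ i) hi
    rw [h1, zero_mul, Finset.prod_eq_zero (Finset.mem_univ i)]
    simp [hi]
  · push Not at h
    rw [Finset.prod_mul_distrib, ← Real.exp_sum, ← Finset.mul_sum, Finset.sum_sub_distrib,
      ← Real.log_prod fun i _ => h i, ← Real.log_prod fun i _ => fun h0 => h i (hPQ _ h0)]
    rfl

lemma logTilted_iid {P Q : X → ℝ} (hPQ : ∀ x, Q x = 0 → P x = 0) (s : ℝ) (n : ℕ) :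
    logTilted s (iid P n) (iid Q n) = n * logTilted s P Q := by
  rw [logTilted, tiltedSum_iid hPQ, Real.log_pow]
  rfl

lemma sum_comp_perm {n : ℕ} (π : Equiv.Perm (Fin n)) (f : (Fin n → X) → ℝ) :
    ∑ x : Fin n → X, f (fun i => x (π i)) = ∑ x, f x :=
  Equiv.sum_comp (Equiv.arrowCongr π.symm (Equiv.refl X)) f

/-- An invariant test cannot tell `q` from its permuted copies. This reduces arbitrary alternatives
to the symmetric ones, which `U^n` dominates. -/
lemma sum_symmetrize_mul {n : ℕ} (q : (Fin n → X) → ℝ) {T : (Fin n → X) → ℝ}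
    (hT : PermInvariant T) : ∑ x, symmetrize q x * T x = ∑ x, q x * T x := by
  have h : ∀ π : Equiv.Perm (Fin n), ∑ x : Fin n → X, q (fun i => x (π i)) * T x
      = ∑ x, q x * T x := by
    intro π
    rw [← sum_comp_perm π fun x => q x * T x]
    exact Finset.sum_congr rfl fun x _ => by rw [hT π x]
  simp only [symmetrize]
  simp_rw [mul_assoc, ← Finset.mul_sum, Finset.sum_mul]
  rw [Finset.sum_comm, Finset.sum_congr rfl fun π _ => h π, Finset.sum_const, Finset.card_univ,
    Fintype.card_perm, Fintype.card_fin, nsmul_eq_mul, ← mul_assoc,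
    one_div_mul_cancel (by positivity), one_mul]

end Products

/-- A convex function that touches a differentiable function from below at an interior point is
differentiable there. -/
lemma differentiableAt_of_convexOn_of_le {S : Set ℝ} {φ f : ℝ → ℝ} {s : ℝ} (hφ : ConvexOn ℝ S φ)
    (hs : s ∈ interior S) (hf : DifferentiableAt ℝ f s) (hle : ∀ t ∈ S, φ t ≤ f t)
    (heq : φ s = f s) : DifferentiableAt ℝ φ s := by
  have hsS := interior_subset hs
  -- The right derivative is a subgradient. Subtracting its line from `f` leaves a local minimum at
  -- `s`, so `m = f'(s)`; then `φ` minus the line lies between `0` and an `o(t - s)`.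
  set m := derivWithin φ (Set.Ioi s) s with hm
  have hsub : ∀ t ∈ S, φ s + m * (t - s) ≤ φ t := by
    intro t ht
    rcases lt_trichotomy t s with h | h | h
    · have h1 := (hφ.slope_le_leftDeriv_of_mem_interior ht hs h).trans
        (hφ.leftDeriv_le_rightDeriv_of_mem_interior hs)
      rw [slope_def_field, div_le_iff₀ (by linarith)] at h1
      linarith
    · simp [h]
    · have h1 := hφ.rightDeriv_le_slope_of_mem_interior hs ht h
      rw [slope_def_field, le_div_iff₀ (by linarith)] at h1
      linarith
  have hS : S ∈ 𝓝 s := mem_interior_iff_mem_nhds.1 hs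
  have hmin : IsLocalMin (fun t => f t - m * (t - s)) s := by
    filter_upwards [hS] with t ht
    have h1 := hsub t ht
    have h2 := hle t ht
    simp only [sub_self, mul_zero, sub_zero]
    linarith
  have hd : HasDerivAt (fun t => f t - m * (t - s)) (deriv f s - m * 1) s :=
    hf.hasDerivAt.sub (((hasDerivAt_id s).sub_const s).const_mul m)
  have hm' : deriv f s = m := by
    have := hmin.hasDerivAt_eq_zero hd
    linarith
  have hfm : HasDerivAt f m s := hm' ▸ hf.hasDerivAt
  refine HasDerivAt.differentiableAt (f' := m) ?_
  rw [hasDerivAt_iff_isLittleO] at hfm ⊢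
  refine Asymptotics.IsBigO.trans_isLittleO (Asymptotics.IsBigO.of_bound 1 ?_) hfm
  filter_upwards [hS] with t ht
  have h1 := hsub t ht
  have h2 := hle t ht
  simp only [smul_eq_mul]
  rw [one_mul, Real.norm_of_nonneg (by linarith), Real.norm_of_nonneg (by linarith)]
  linarith

lemma eventually_log_eval_le (v : Polynomial ℝ) (hv : ∀ n : ℕ, 1 ≤ n → 1 ≤ v.eval (n : ℝ)) {ε : ℝ}
    (hε : 0 < ε) : ∀ᶠ n : ℕ in atTop, Real.log (v.eval (n : ℝ)) ≤ n * ε := by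
  -- The rescaled polynomial `v(x/ε)` is `o(exp x)`; evaluate at `x = nε`.
  have h1 := (Polynomial.tendsto_div_exp_atTop (v.comp (Polynomial.C (1 / ε) * Polynomial.X))).comp
    (tendsto_natCast_atTop_atTop.atTop_mul_const hε)
  filter_upwards [h1.eventually (gt_mem_nhds one_pos), eventually_ge_atTop 1] with n hn hn1
  simp only [Function.comp, Polynomial.eval_comp, Polynomial.eval_mul, Polynomial.eval_C,
    Polynomial.eval_X] at hn
  have e : 1 / ε * (n * ε) = n := by field_simp
  rw [e, div_lt_one (Real.exp_pos _)] at hn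
  rw [Real.log_le_iff_le_exp (by linarith [hv n hn1])]
  exact hn.le

/-! ### From error probabilities to exponents. -/

section Exponents

lemma le_neg_log_div {x E : ℝ} {n : ℕ} (hn : 1 ≤ n) (hx : x ≤ Real.exp (-(n * E))) :
    (E : EReal) ≤ -(ENNReal.log (ENNReal.ofReal x) / ((n : ℝ) : EReal)) := by
  have hn0 : (0 : ℝ) < n := by exact_mod_cast hn
  have h1 : ENNReal.log (ENNReal.ofReal x) ≤ ((-(n * E) : ℝ) : EReal) := by
    calc _ ≤ ENNReal.log (ENNReal.ofReal (Real.exp (-(n * E)))) :=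
          ENNReal.log_le_log_iff.2 (ENNReal.ofReal_le_ofReal hx)
      _ = _ := by rw [ENNReal.log_ofReal_of_pos (Real.exp_pos _), Real.log_exp]
  have h2 := EReal.div_le_div_right_of_nonneg
    (show (0 : EReal) ≤ ((n : ℝ) : EReal) by exact_mod_cast hn0.le) h1
  rw [← EReal.coe_div] at h2
  have h3 := EReal.neg_le_neg_iff.2 h2
  refine le_trans (le_of_eq ?_) h3
  rw [← EReal.coe_neg]
  congr 1
  field_simp

lemma neg_log_div_le {x E : ℝ} {n : ℕ} (hn : 1 ≤ n) (hx : Real.exp (-(n * E)) ≤ x) :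
    -(ENNReal.log (ENNReal.ofReal x) / ((n : ℝ) : EReal)) ≤ (E : EReal) := by
  have hn0 : (0 : ℝ) < n := by exact_mod_cast hn
  have h1 : ((-(n * E) : ℝ) : EReal) ≤ ENNReal.log (ENNReal.ofReal x) := by
    calc _ = ENNReal.log (ENNReal.ofReal (Real.exp (-(n * E)))) := by
          rw [ENNReal.log_ofReal_of_pos (Real.exp_pos _), Real.log_exp]
      _ ≤ _ := ENNReal.log_le_log_iff.2 (ENNReal.ofReal_le_ofReal hx)
  have h2 := EReal.div_le_div_right_of_nonneg
    (show (0 : EReal) ≤ ((n : ℝ) : EReal) by exact_mod_cast hn0.le) h1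
  rw [← EReal.coe_div] at h2
  have h3 := EReal.neg_le_neg_iff.2 h2
  refine le_trans h3 (le_of_eq ?_)
  rw [← EReal.coe_neg]
  congr 1
  field_simp

variable {Y : Type*} [Fintype Y]

lemma typeI_eq {P : Y → ℝ} (hP : P ∈ stdSimplex ℝ Y) (T : Y → ℝ) :
    typeI T P = 1 - ∑ y, P y * T y := by
  simp only [typeI, mul_sub, mul_one, Finset.sum_sub_distrib, hP.2]

/-- Every alternative bounds the success probability `1 - α̂`. -/
lemma one_sub_alphaHat_le {P q : Y → ℝ} {S : Set (Y → ℝ)} (hP : P ∈ stdSimplex ℝ Y)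
    (hS : S ⊆ stdSimplex ℝ Y) (hq : q ∈ S) (hPq : ∀ y, q y = 0 → P y = 0) {s ρ : ℝ} (hs : 1 < s) :
    1 - alphaHat (Real.exp (-ρ)) P S ≤ Real.exp (-(((s - 1) * ρ - logTilted s P q) / s)) := by
  have h : 1 - Real.exp (-(((s - 1) * ρ - logTilted s P q) / s)) ≤
      alphaHat (Real.exp (-ρ)) P S := by
    unfold alphaHat
    refine le_csInf (Set.Nonempty.image _ ?_) ?_
    · refine ⟨fun _ => (0 : ℝ), fun y => ⟨le_rfl, zero_le_one⟩, ?_⟩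
      refine Real.sSup_le ?_ (Real.exp_pos _).le
      rintro _ ⟨r, -, rfl⟩
      simpa using (Real.exp_pos (-ρ)).le
    · rintro _ ⟨T, ⟨hT, hT2⟩, rfl⟩
      have hqT : ∑ y, q y * T y ≤ Real.exp (-ρ) := by
        -- The bound `1` is needed because a real supremum is meaningful only for sets bounded
        -- above.
        refine le_trans (le_csSup ⟨1, ?_⟩
          (Set.mem_image_of_mem (fun q : Y → ℝ => ∑ y, q y * T y) hq)) hT2
        rintro _ ⟨r, hr, rfl⟩
        calc ∑ y, r y * T y ≤ ∑ y, r y := Finset.sum_le_sum fun y _ =>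
              mul_le_of_le_one_right ((hS hr).1 y) (hT y).2
          _ = 1 := (hS hr).2
      have := sum_mul_test_le hP (hS hq).1 hPq hT hs hqT
      simp only [typeI_eq hP]
      linarith
  linarith

/-- Every admissible test bounds the success probability `1 - α̂` from below. -/
lemma le_one_sub_alphaHat {P T : Y → ℝ} {S : Set (Y → ℝ)} (hP : P ∈ stdSimplex ℝ Y)
    (hT : ∀ y, T y ∈ Set.Icc (0 : ℝ) 1) {μ : ℝ} (hμ : 0 ≤ μ)
    (hST : ∀ q ∈ S, ∑ y, q y * T y ≤ μ) : ∑ y, P y * T y ≤ 1 - alphaHat μ P S := by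
  have h : alphaHat μ P S ≤ typeI T P := by
    refine csInf_le ⟨0, ?_⟩ ⟨T, ⟨hT, Real.sSup_le ?_ hμ⟩, rfl⟩
    · rintro _ ⟨T', ⟨hT', -⟩, rfl⟩
      exact Finset.sum_nonneg fun y _ => mul_nonneg (hP.1 y) (by linarith [(hT' y).2])
    · rintro _ ⟨q, hq, rfl⟩
      exact hST q hq
  rw [typeI_eq hP] at h
  linarith

end Exponents

/-- The open interval `(1, b)` of orders. -/
def openOrders (b : EReal) : Set ℝ := {s | 1 < s ∧ (s : EReal) < b}

lemma isOpen_openOrders (b : EReal) : IsOpen (openOrders b) :=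
  (isOpen_lt continuous_const continuous_id).inter
    (isOpen_lt continuous_coe_real_ereal continuous_const)

lemma ordConnected_openOrders (b : EReal) : (openOrders b).OrdConnected :=
  ⟨fun _ hs _ ht _ hu => ⟨hs.1.trans_le hu.1,
    (EReal.coe_le_coe_iff.2 hu.2).trans_lt ht.2⟩⟩

lemma exists_mem_openOrders {b : EReal} (hb : 1 < b) : ∃ s, s ∈ openOrders b := by
  obtain ⟨s, h1, h2⟩ := EReal.lt_iff_exists_real_btwn.1 hb
  exact ⟨s, by exact_mod_cast h1, h2⟩

lemma openOrders_subset_orders (b : EReal) : openOrders b ⊆ orders b := fun _ hs => ⟨hs.1.le, hs.2⟩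

lemma upTo_neBot {b : EReal} (hb : 1 < b) : (upTo b).NeBot := by
  refine comap_neBot fun t ht => ?_
  obtain ⟨a, ha, hat⟩ := (nhdsLT_basis_of_exists_lt ⟨1, hb⟩).mem_iff.1 ht
  obtain ⟨s, h1, h2⟩ := EReal.lt_iff_exists_real_btwn.1 ha
  exact ⟨s, hat ⟨h1, h2⟩⟩

lemma eventually_upTo {b : EReal} {s : ℝ} (hs : (s : EReal) < b) :
    ∀ᶠ t : ℝ in upTo b, s < t ∧ (t : EReal) < b := by
  refine (eventually_comap.2 ?_)
  filter_upwards [Ioo_mem_nhdsLT hs] with x hx t ht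
  subst ht
  exact ⟨EReal.coe_lt_coe_iff.1 hx.1, hx.2⟩

/-! ### The function `φ` and the strong converse bound. -/

namespace Problem

variable {X : Type*} [Fintype X] (H : Problem X)

lemma base_subset : H.base ⊆ stdSimplex ℝ X := by
  intro q hq
  have h := H.Q_subset 1 hq
  refine ⟨fun x => h.1 fun _ => x, ?_⟩
  rw [← h.2]
  exact (Equiv.sum_comp (Equiv.funUnique (Fin 1) X) q).symm

/-- A distribution in the base set whose support contains that of `P`. -/
def Dominating (q : X → ℝ) : Prop := q ∈ H.base ∧ ∀ x, q x = 0 → H.P x = 0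

variable {H} {b : EReal}

lemma Dominating.mem_stdSimplex {q : X → ℝ} (hq : H.Dominating q) : q ∈ stdSimplex ℝ X :=
  H.base_subset hq.1

lemma Dominating.logTilted_iid {q : X → ℝ} (hq : H.Dominating q) (s : ℝ) (n : ℕ) :
    logTilted s (iid H.P n) (iid q n) = n * logTilted s H.P q :=
  CompositeTesting.logTilted_iid hq.2 s n

/-- A minimizer must dominate `P`: otherwise its divergence is `⊤`, while the support hypothesis
supplies a finite competitor. -/
lemma exists_dominating_eq (hpara : H.ConvexParametrizationOn b)
    (hsupp : ∃ q ∈ H.base, ∀ x, q x = 0 → H.P x = 0) {s : ℝ} (hs : s ∈ openOrders b) :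
    ∃ q, H.Dominating q ∧
      renyiSet s H.P H.base = ((logTilted s H.P q / (s - 1) : ℝ) : EReal) := by
  obtain ⟨d, Θ, q, -, -, -, himg, -, hmin⟩ := hpara
  obtain ⟨θ, hθ, hθmin, -⟩ := hmin s (openOrders_subset_orders b hs)
  have hθ' : θ ∈ Θ := intrinsicInterior_subset hθ
  have hbase : q θ ∈ H.base := himg ▸ ⟨θ, hθ', rfl⟩
  have hle : ∀ r ∈ H.base, renyi s H.P (q θ) ≤ renyi s H.P r := by
    intro r hr
    rw [← himg] at hr
    obtain ⟨θ', h', rfl⟩ := hr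
    exact hθmin h'
  have hdom : ∀ x, q θ x = 0 → H.P x = 0 := by
    by_contra hcon
    obtain ⟨r, hr, hPr⟩ := hsupp
    have h1 := hle r hr
    rw [renyi_eq_top H.P_mem.1 hcon hs.1,
      renyi_eq_logTilted H.P_mem (H.base_subset hr).1 hPr hs.1] at h1
    exact EReal.coe_ne_top _ (top_le_iff.1 h1)
  refine ⟨q θ, ⟨hbase, hdom⟩, ?_⟩
  rw [← renyi_eq_logTilted H.P_mem (H.base_subset hbase).1 hdom hs.1]
  exact le_antisymm (iInf₂_le _ hbase) (le_iInf₂ hle)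

/-- The problem has dominating distributions attaining `D_s(P‖𝒬)` for orders in `(1, b)`. -/
def AttainedOn (H : Problem X) (b : EReal) : Prop := ∀ s ∈ openOrders b,
  ∃ q, H.Dominating q ∧ renyiSet s H.P H.base = ((logTilted s H.P q / (s - 1) : ℝ) : EReal)

lemma AttainedOn.renyiSet_eq (hatt : H.AttainedOn b) {s : ℝ} (hs : s ∈ openOrders b) :
    renyiSet s H.P H.base = ((H.phi s / (s - 1) : ℝ) : EReal) := by
  obtain ⟨q, -, h⟩ := hatt s hs
  have : s - 1 ≠ 0 := (sub_pos.2 hs.1).ne'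
  rw [phi, h, EReal.toReal_coe]
  congr 1
  field_simp

lemma AttainedOn.exists_phi_eq (hatt : H.AttainedOn b) {s : ℝ} (hs : s ∈ openOrders b) :
    ∃ q, H.Dominating q ∧ H.phi s = logTilted s H.P q := by
  obtain ⟨q, hq, h⟩ := hatt s hs
  have : s - 1 ≠ 0 := (sub_pos.2 hs.1).ne'
  refine ⟨q, hq, ?_⟩
  rw [phi, h, EReal.toReal_coe]
  field_simp

lemma AttainedOn.phi_le (hatt : H.AttainedOn b) {s : ℝ} (hs : s ∈ openOrders b) {q : X → ℝ}
    (hq : H.Dominating q) : H.phi s ≤ logTilted s H.P q := by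
  have h1 : renyiSet s H.P H.base ≤ renyi s H.P q := iInf₂_le q hq.1
  rw [hatt.renyiSet_eq hs, renyi_eq_logTilted H.P_mem hq.mem_stdSimplex.1 hq.2 hs.1,
    EReal.coe_le_coe_iff] at h1
  exact (div_le_div_iff_of_pos_right (sub_pos.2 hs.1)).1 h1

lemma AttainedOn.phi_nonneg (hatt : H.AttainedOn b) {s : ℝ} (hs : s ∈ openOrders b) :
    0 ≤ H.phi s := by
  obtain ⟨q, hq, h⟩ := hatt.exists_phi_eq hs
  rw [h]
  exact logTilted_nonneg H.P_mem hq.mem_stdSimplex hq.2 hs.1.le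

lemma AttainedOn.objective_eq (hatt : H.AttainedOn b) {s : ℝ} (hs : s ∈ openOrders b) (R : ℝ) :
    (((s - 1) / s : ℝ) : EReal) * ((R : EReal) - renyiSet s H.P H.base) =
      ((((s - 1) * R - H.phi s) / s : ℝ) : EReal) := by
  rw [hatt.renyiSet_eq hs, ← EReal.coe_sub, ← EReal.coe_mul]
  have h1 : s - 1 ≠ 0 := (sub_pos.2 hs.1).ne'
  have h2 : s ≠ 0 := by linarith [hs.1]
  congr 1
  field_simp

lemma AttainedOn.scBound_le_iff (hatt : H.AttainedOn b) {R : ℝ} {c : EReal} :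
    H.scBound b R ≤ c ↔
      ∀ s ∈ openOrders b, ((((s - 1) * R - H.phi s) / s : ℝ) : EReal) ≤ c := by
  unfold scBound
  rw [iSup₂_le_iff]
  refine forall₂_congr fun s hs => ?_
  rw [hatt.objective_eq hs]

/-- The strong converse bound, which only needs the product distributions. -/
lemma AttainedOn.scBound_le_sc (hatt : H.AttainedOn b) (hprod : H.ProductDistributions) (R : ℝ) :
    H.scBound b R ≤ H.sc R := by
  rw [hatt.scBound_le_iff]
  intro s hs
  obtain ⟨q, hq, hphi⟩ := hatt.exists_phi_eq hs
  refine le_limsup_of_frequently_le (Eventually.frequently ?_)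
  filter_upwards [eventually_ge_atTop 1] with n hn
  refine le_neg_log_div hn ?_
  have h := one_sub_alphaHat_le (ρ := n * R) (iid_mem_stdSimplex H.P_mem n) (H.Q_subset n)
    (hprod n hn q hq.1) (iid_dominated hq.2 n) hs.1
  rw [hq.logTilted_iid, ← hphi] at h
  convert h using 3
  ring

/-- What the universal distributions provide: the sequence `U` has, up to a polynomial factor `v`,
the same Rényi divergences and the same type-II errors of symmetric tests as the alternatives. -/
structure IsUniversal (H : Problem X) (b : EReal) (U : (n : ℕ) → (Fin n → X) → ℝ)
    (v : Polynomial ℝ) (n : ℕ) : Prop where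
  nonneg : ∀ x, 0 ≤ U n x
  permInvariant : PermInvariant (U n)
  one_le_eval : 1 ≤ v.eval (n : ℝ)
  dominated : ∀ x, U n x = 0 → iid H.P n x = 0
  sum_le : ∀ q ∈ H.Q n, ∀ T : (Fin n → X) → ℝ, (∀ x, 0 ≤ T x) → PermInvariant T →
    ∑ x, q x * T x ≤ v.eval (n : ℝ) * ∑ x, U n x * T x
  le_logTilted : ∀ s ∈ openOrders b, n * H.phi s ≤ logTilted s (iid H.P n) (U n)
  logTilted_le : ∀ s ∈ openOrders b,
    logTilted s (iid H.P n) (U n) ≤ n * H.phi s + (s - 1) * Real.log (v.eval (n : ℝ))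

lemma exists_isUniversal (hatt : H.AttainedOn b) (hprod : H.ProductDistributions)
    (hadd : H.AdditivityOn b) (huniv : H.UniversalOn b)
    (hsupp : ∃ q ∈ H.base, ∀ x, q x = 0 → H.P x = 0) :
    ∃ U v, ∀ n : ℕ, 1 ≤ n → H.IsUniversal b U v n := by
  obtain ⟨⟨U, v, hU⟩, hsym⟩ := huniv
  refine ⟨U, v, fun n hn => ?_⟩
  obtain ⟨hUmem, hUperm, hle, hren⟩ := hU n hn
  obtain ⟨q₀, hq₀, hPq₀⟩ := hsupp
  have hiid : ∀ q ∈ H.base, iid q n ∈ H.Qsym n := fun q hq =>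
    ⟨hprod n hn q hq, permInvariant_iid q n⟩
  -- Sum the domination of one product distribution over `X^n`; both sides carry total mass `1`.
  have hone : 1 ≤ v.eval (n : ℝ) := by
    have h := Finset.sum_le_sum fun x (_ : x ∈ Finset.univ) => hle _ (hiid q₀ hq₀) x
    rwa [(H.Q_subset n (hiid q₀ hq₀).1).2, ← Finset.mul_sum, hUmem.2, mul_one] at h
  have hPn := iid_mem_stdSimplex H.P_mem n
  have hdom : ∀ x, U n x = 0 → iid H.P n x = 0 := by
    intro x hx
    have h := hle _ (hiid q₀ hq₀) x
    rw [hx, mul_zero] at h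
    exact iid_dominated hPq₀ n x (le_antisymm h ((H.Q_subset n (hiid q₀ hq₀).1).1 x))
  refine ⟨hUmem.1, hUperm, hone, hdom, ?_, ?_, ?_⟩
  · intro q hq T hT hTperm
    rw [← sum_symmetrize_mul q hTperm, Finset.mul_sum]
    refine Finset.sum_le_sum fun x _ => ?_
    rw [← mul_assoc]
    exact mul_le_mul_of_nonneg_right (hle _ (hsym n hn q hq) x) (hT x)
  · intro s hs
    have h := (hadd s (openOrders_subset_orders b hs) n hn).trans
      (hren s (openOrders_subset_orders b hs))
    rw [hatt.renyiSet_eq hs, renyi_eq_logTilted hPn hUmem.1 hdom hs.1, ← EReal.coe_mul,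
      EReal.coe_le_coe_iff, ← mul_div_assoc] at h
    exact (div_le_div_iff_of_pos_right (sub_pos.2 hs.1)).1 h
  · intro s hs
    obtain ⟨q, hq, hphi⟩ := hatt.exists_phi_eq hs
    rw [hphi, ← hq.logTilted_iid]
    exact logTilted_le_of_le_mul hPn (H.Q_subset n (hiid q hq.1).1).1 (iid_dominated hq.2 n)
      (by linarith) (hle _ (hiid q hq.1)) hs.1.le

section Universal

variable {U : (n : ℕ) → (Fin n → X) → ℝ} {v : Polynomial ℝ}

/-- A minimum of convex functions need not be convex. Here `φ` is the limit of `(1/n) log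
g_s(P^{×n}‖U^n)`, where `U^n` does not depend on `s`. -/
lemma convexOn_phi (hU : ∀ n : ℕ, 1 ≤ n → H.IsUniversal b U v n) :
    ConvexOn ℝ (openOrders b) H.phi := by
  have hconv : Convex ℝ (openOrders b) := (ordConnected_openOrders b).convex
  refine ⟨hconv, fun s hs t ht a c ha hc hac => ?_⟩
  have hmem := hconv hs ht ha hc hac
  set u := a • s + c • t with hu
  simp only [smul_eq_mul] at hu ⊢
  refine le_of_forall_pos_le_add fun ε hε => ?_
  have hpos : 0 < s + t := by linarith [hs.1, ht.1]
  obtain ⟨n, hn, hn1⟩ := ((eventually_log_eval_le v (fun n hn => (hU n hn).one_le_eval)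
    (div_pos hε hpos)).and (eventually_ge_atTop 1)).exists
  have hn0 : (0 : ℝ) < n := by exact_mod_cast hn1
  have hUn := hU n hn1
  have hPn := iid_mem_stdSimplex H.P_mem n
  have h1 := (convexOn_logTilted hPn (U n)).2 (Set.mem_univ s) (Set.mem_univ t) ha hc hac
  simp only [smul_eq_mul] at h1
  rw [← hu] at h1
  have h2 := hUn.le_logTilted u hmem
  have h3 := mul_le_mul_of_nonneg_left (hUn.logTilted_le s hs) ha
  have h4 := mul_le_mul_of_nonneg_left (hUn.logTilted_le t ht) hc
  have hl : 0 ≤ Real.log (v.eval (n : ℝ)) := Real.log_nonneg hUn.one_le_eval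
  have h5 : (a * (s - 1) + c * (t - 1)) * Real.log (v.eval (n : ℝ)) ≤ n * ε := by
    have e : (s + t) * (n * (ε / (s + t))) = n * ε := by field_simp
    rw [← e]
    refine mul_le_mul ?_ hn hl hpos.le
    nlinarith [hs.1, ht.1]
  have h6 : n * H.phi u ≤ n * (a * H.phi s + c * H.phi t + ε) := by linarith
  exact le_of_mul_le_mul_left h6 hn0

lemma AttainedOn.differentiableAt_phi (hatt : H.AttainedOn b)
    (hconv : ConvexOn ℝ (openOrders b) H.phi) {s : ℝ} (hs : s ∈ openOrders b) :
    DifferentiableAt ℝ H.phi s := by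
  obtain ⟨q, hq, hphi⟩ := hatt.exists_phi_eq hs
  exact differentiableAt_of_convexOn_of_le hconv ((isOpen_openOrders b).interior_eq.symm ▸ hs)
    (differentiable_logTilted H.P_mem q s) (fun t ht => hatt.phi_le ht hq) hphi

/-- Achievability: a rate that exceeds `sφ'(s) - φ(s)` by at most `η` has exponent at most
`(s-1)φ'(s) - φ(s) + η`. -/
lemma sc_le_of_le (hU : ∀ n : ℕ, 1 ≤ n → H.IsUniversal b U v n) {s R η : ℝ}
    (hs : s ∈ openOrders b) (hd : DifferentiableAt ℝ H.phi s) (hη : 0 ≤ η)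
    (hR : R ≤ s * deriv H.phi s - H.phi s + η) :
    H.sc R ≤ (((s - 1) * deriv H.phi s - H.phi s + η : ℝ) : EReal) := by
  rw [← EReal.le_of_forall_lt_iff_le]
  intro c hc
  rw [EReal.coe_lt_coe_iff] at hc
  set a := deriv H.phi s with ha
  have hs1 := hs.1
  -- The losses in the exponent are `2sε` from scaling the test, `(s-1)ε` from the upper edge of the
  -- window and `ε` from the factor `2`; `3s + 1` covers them.
  set ε := (c - ((s - 1) * a - H.phi s + η)) / (3 * s + 1) with hε
  have hεpos : 0 < ε := div_pos (by linarith) (by linarith)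
  have hcε : c = (s - 1) * a - H.phi s + η + (3 * s + 1) * ε := by
    rw [hε]; field_simp; ring
  -- a step `h` on which `φ` is almost linear
  obtain ⟨h, hh, hup, hlow, hsp, hsm⟩ : ∃ h : ℝ, 0 < h ∧
      H.phi (s + h) - H.phi s ≤ h * (a + ε / 2) ∧ H.phi (s - h) - H.phi s ≤ -(h * (a - ε / 2)) ∧
      s + h ∈ openOrders b ∧ s - h ∈ openOrders b := by
    have h1 := (hasDerivAt_iff_isLittleO_nhds_zero.1 hd.hasDerivAt).def (half_pos hεpos)
    have hneg : Tendsto (fun h : ℝ => -h) (𝓝 0) (𝓝 0) := by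
      simpa using (continuous_neg (G := ℝ)).tendsto 0
    have h2 := hneg.eventually h1
    have hmem : ∀ᶠ h : ℝ in 𝓝 0, s + h ∈ openOrders b := by
      refine (continuous_const.add continuous_id).tendsto' 0 s (by simp) |>.eventually ?_
      exact (isOpen_openOrders b).mem_nhds hs
    have hall := ((h1.and h2).and (hmem.and (hneg.eventually hmem))).filter_mono
      (nhdsWithin_le_nhds (s := Set.Ioi (0 : ℝ)))
    obtain ⟨h, ⟨⟨b1, b2⟩, m1, m2⟩, hh⟩ := (hall.and self_mem_nhdsWithin).exists
    have hh' : 0 < h := hh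
    simp only [smul_eq_mul, Real.norm_eq_abs, abs_neg, abs_of_pos hh'] at b1 b2
    rw [← ha] at b1 b2
    rw [← sub_eq_add_neg] at m2 b2
    refine ⟨h, hh', ?_, ?_, m1, m2⟩
    · linarith [le_abs_self (H.phi (s + h) - H.phi s - h * a)]
    · linarith [le_abs_self (H.phi (s - h) - H.phi s - -h * a)]
  -- Linearity of `φ` up to `hε/2` leaves a Chernoff gain of `nhε/2`: half absorbs `log v(n)`, half
  -- absorbs `log 4`.
  have hδ : 0 < min ε (h * ε / (4 * (s + h))) := by positivity
  refine limsup_le_of_le (by isBoundedDefault) ?_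
  filter_upwards [eventually_ge_atTop 1,
    eventually_log_eval_le v (fun n hn => (hU n hn).one_le_eval) hδ,
    (tendsto_natCast_atTop_atTop.atTop_mul_const (show 0 < min ε (h * ε / 4) by positivity)
      ).eventually_ge_atTop (Real.log 4)] with n hn hvn hn4
  have hn0 : (0 : ℝ) < n := by exact_mod_cast hn
  have hUn := hU n hn
  have hPn := iid_mem_stdSimplex H.P_mem n
  set l := Real.log (v.eval (n : ℝ)) with hl
  have hl0 : 0 ≤ l := Real.log_nonneg hUn.one_le_eval
  have hl1 : l ≤ n * ε := hvn.trans (by gcongr; exact min_le_left _ _)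
  have hl2 : (s + h) * l ≤ n * (h * ε / 4) := by
    calc (s + h) * l ≤ (s + h) * (n * (h * ε / (4 * (s + h)))) := by
          gcongr; exact hvn.trans (by gcongr; exact min_le_right _ _)
      _ = _ := by field_simp
  have hlog4 : Real.log 4 ≤ n * (h * ε / 4) := hn4.trans (by gcongr; exact min_le_right _ _)
  have hlog4' : Real.log 4 ≤ n * ε := hn4.trans (by gcongr; exact min_le_left _ _)
  have hlog2 : Real.log 2 ≤ Real.log 4 := Real.log_le_log (by norm_num) (by norm_num)
  have hLs := hUn.le_logTilted s hs
  have hLs' := hUn.logTilted_le s hs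
  -- the test accepts a window of log-likelihood ratios, with probability `exp(-nδ)`
  classical
  set E : (Fin n → X) → Prop := fun x => 0 < iid H.P n x ∧
    n * (a - ε) ≤ Real.log (iid H.P n x) - Real.log (U n x) ∧
    Real.log (iid H.P n x) - Real.log (U n x) ≤ n * (a + ε) with hE
  have hEperm : ∀ (π : Equiv.Perm (Fin n)) (x : Fin n → X), E (fun i => x (π i)) = E x := by
    intro π x
    simp only [hE, permInvariant_iid H.P n π x, hUn.permInvariant π x]
  obtain ⟨hmassP, hmassU⟩ := window_bounds hPn hUn.nonneg hUn.dominated hs1 hh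
    (lo := n * (a - ε)) (hi := n * (a + ε)) (by
      have h1 := hUn.logTilted_le (s + h) hsp
      have h2 := mul_le_mul_of_nonneg_left hup hn0.le
      have h3 := mul_nonneg hn0.le (mul_pos hh hεpos).le
      linarith) (by
      have h1 := hUn.logTilted_le (s - h) hsm
      have h2 := mul_le_mul_of_nonneg_left hlow hn0.le
      have h3 := mul_nonneg hh.le hl0
      linarith) E (fun _ => Iff.rfl)
  -- Scaling by `exp(-nδ)` makes up the missing rate `η`, the loss `sε` from the lower edge of the
  -- window and the loss `sε` from `v(n)^s`.
  set δ := η + 2 * s * ε with hδdef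
  set T : (Fin n → X) → ℝ := fun x => Real.exp (-(n * δ)) * (if E x then 1 else 0) with hT
  have hδ0 : 0 ≤ δ := by positivity
  have hT01 : ∀ x, T x ∈ Set.Icc (0 : ℝ) 1 := by
    intro x
    have h1 : Real.exp (-(n * δ)) ≤ 1 := Real.exp_le_one_iff.2 (by nlinarith)
    simp only [hT]
    split_ifs
    · simpa using ⟨(Real.exp_pos _).le, by nlinarith⟩
    · simp
  have hTperm : PermInvariant T := fun π x => by simp only [hT, hEperm π x]
  have hsum : ∀ q : (Fin n → X) → ℝ,
      ∑ x, q x * T x = Real.exp (-(n * δ)) * ∑ x, q x * (if E x then 1 else 0) := by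
    intro q
    rw [Finset.mul_sum]
    exact Finset.sum_congr rfl fun x _ => by simp only [hT]; ring
  refine neg_log_div_le hn (le_trans ?_ (le_one_sub_alphaHat hPn hT01 (Real.exp_pos _).le ?_))
  · rw [hsum]
    calc Real.exp (-(n * c)) ≤ Real.exp (-(n * δ) +
          (logTilted s (iid H.P n) (U n) - (s - 1) * (n * (a + ε)) - Real.log 2)) := by
          refine Real.exp_le_exp.2 ?_
          have := mul_pos hn0 hεpos
          rw [hcε, hδdef]
          linarith
      _ = Real.exp (-(n * δ)) *
          (Real.exp (logTilted s (iid H.P n) (U n) - (s - 1) * (n * (a + ε))) / 2) := by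
          rw [Real.exp_add, Real.exp_sub _ (Real.log 2), Real.exp_log (by norm_num)]
      _ ≤ _ := by gcongr
  · intro q hq
    calc ∑ x, q x * T x ≤ v.eval (n : ℝ) * ∑ x, U n x * T x :=
          hUn.sum_le q hq T (fun x => (hT01 x).1) hTperm
      _ ≤ Real.exp l * (Real.exp (-(n * δ)) *
          Real.exp (logTilted s (iid H.P n) (U n) - s * (n * (a - ε)))) := by
          rw [hsum, hl, Real.exp_log (by linarith [hUn.one_le_eval])]
          have := hUn.one_le_eval
          gcongr
      _ = Real.exp (l + (-(n * δ) +
          (logTilted s (iid H.P n) (U n) - s * (n * (a - ε))))) := by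
          rw [Real.exp_add, Real.exp_add]
      _ ≤ _ := by
          refine Real.exp_le_exp.2 ?_
          have h1 := mul_le_mul_of_nonneg_left hR hn0.le
          have h2 : s * l ≤ s * (n * ε) := by gcongr
          rw [hδdef]
          linarith

end Universal

/-! ### Critical rate and optimization over the order. -/

lemma monotoneOn_psi (hconv : ConvexOn ℝ (openOrders b) H.phi)
    (hd : ∀ s ∈ openOrders b, DifferentiableAt ℝ H.phi s) : MonotoneOn H.psi (openOrders b) := by
  intro s hs t ht hst
  rcases hst.eq_or_lt with rfl | hlt
  · exact le_rfl
  · refine EReal.coe_le_coe_iff.2 ?_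
    -- The increment is `s(φ'(t) - φ'(s))` plus `(t-s)φ'(t) - (φ(t) - φ(s))`, both nonnegative by
    -- convexity, so no second derivative is needed.
    have h1 := hconv.slope_le_deriv hs ht hlt (hd t ht)
    have h2 := hconv.monotoneOn_deriv hd hs ht hst
    rw [slope_def_field, div_le_iff₀ (sub_pos.2 hlt)] at h1
    nlinarith [hs.1]

lemma tendsto_psi (hconv : ConvexOn ℝ (openOrders b) H.phi)
    (hd : ∀ s ∈ openOrders b, DifferentiableAt ℝ H.phi s) (hb : 1 < b) :
    Tendsto H.psi (upTo b) (𝓝 (H.criticalRate b)) := by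
  -- By monotonicity the limit exists and equals the supremum.
  refine tendsto_nhds_limUnder ⟨⨆ s ∈ openOrders b, H.psi s, ?_⟩
  rw [tendsto_order]
  constructor
  · intro c hc
    obtain ⟨s, hc'⟩ := lt_iSup_iff.1 hc
    obtain ⟨hs, hcs⟩ := lt_iSup_iff.1 hc'
    filter_upwards [eventually_upTo hs.2] with t ht
    exact hcs.trans_le (monotoneOn_psi hconv hd hs ⟨hs.1.trans ht.1, ht.2⟩ ht.1.le)
  · intro c hc
    filter_upwards [eventually_upTo (s := 1) (by exact_mod_cast hb)] with t ht
    exact (le_iSup₂ (f := fun s (_ : s ∈ openOrders b) => H.psi s) t ht).trans_lt hc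

/-- The derivative of `((s-1)R - φ(s))/s` is `(R - (sφ'(s) - φ(s)))/s²`. -/
lemma hasDerivAt_objective {s : ℝ} (hs : s ∈ openOrders b) (hd : DifferentiableAt ℝ H.phi s)
    (R : ℝ) : HasDerivAt (fun s => ((s - 1) * R - H.phi s) / s)
      ((R - (s * deriv H.phi s - H.phi s)) / s ^ 2) s := by
  have hs0 : s ≠ 0 := by linarith [hs.1]
  have h := ((((hasDerivAt_id s).sub_const 1).mul_const R).sub hd.hasDerivAt).div
    (hasDerivAt_id s) hs0
  refine HasDerivAt.congr_deriv h ?_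
  simp only [id, Pi.sub_apply]
  ring

/-- The rates `sφ'(s) - φ(s)` fill an interval. -/
lemma exists_eq_of_le_of_le (hd : ∀ s ∈ openOrders b, DifferentiableAt ℝ H.phi s) {R s t : ℝ}
    (hs : s ∈ openOrders b) (ht : t ∈ openOrders b) (hst : s ≤ t)
    (hsR : s * deriv H.phi s - H.phi s ≤ R) (htR : R ≤ t * deriv H.phi t - H.phi t) :
    ∃ u ∈ openOrders b, u * deriv H.phi u - H.phi u = R := by
  rcases hsR.eq_or_lt with h1 | h1
  · exact ⟨s, hs, h1⟩
  rcases htR.eq_or_lt with h2 | h2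
  · exact ⟨t, ht, h2.symm⟩
  have hIcc : Set.Icc s t ⊆ openOrders b := (ordConnected_openOrders b).out hs ht
  have hs2 : 0 < s ^ 2 := by have := hs.1; positivity
  have ht2 : 0 < t ^ 2 := by have := ht.1; positivity
  -- Darboux's theorem: the derivative of the objective changes sign, so it vanishes somewhere,
  -- without assuming `φ'` continuous.
  obtain ⟨u, hu, h0⟩ := exists_hasDerivWithinAt_eq_of_lt_of_gt hst
    (fun u hu => (hasDerivAt_objective (hIcc hu) (hd u (hIcc hu)) R).hasDerivWithinAt)
    (div_pos (sub_pos.2 h1) hs2) (div_neg_of_neg_of_pos (sub_neg.2 h2) ht2)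
  have hu' := hIcc (Set.Ioo_subset_Icc_self hu)
  have hu2 : u ^ 2 ≠ 0 := by have := hu'.1; positivity
  refine ⟨u, hu', ?_⟩
  have := (div_eq_zero_iff.1 h0).resolve_right hu2
  linarith

/-- Near order `1`, the exponents `φ(s)` and `(s-1)φ'(s) - φ(s)` are arbitrarily small. -/
lemma AttainedOn.exists_near_one (hatt : H.AttainedOn b) (hb : 1 < b)
    (hconv : ConvexOn ℝ (openOrders b) H.phi)
    (hd : ∀ s ∈ openOrders b, DifferentiableAt ℝ H.phi s) {η : ℝ} (hη : 0 < η) :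
    ∃ s ∈ openOrders b, H.phi s ≤ η ∧ (s - 1) * deriv H.phi s - H.phi s ≤ η := by
  obtain ⟨t, ht⟩ := exists_mem_openOrders hb
  obtain ⟨q, hq, -⟩ := hatt.exists_phi_eq ht
  have hcont : Tendsto (fun s => logTilted s H.P q) (𝓝 1) (𝓝 0) := by
    have h := (differentiable_logTilted H.P_mem q).continuous.tendsto 1
    rwa [logTilted_one H.P_mem] at h
  have hcont2 : Tendsto (fun s => (s - 1) * deriv H.phi t) (𝓝 1) (𝓝 0) :=
    ((continuous_id.sub continuous_const).mul continuous_const).tendsto' _ _ (by simp)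
  have hall := ((hcont.eventually (gt_mem_nhds hη)).and
    (hcont2.eventually (gt_mem_nhds hη))).filter_mono
    (nhdsWithin_le_nhds (s := Set.Ioi (1 : ℝ)))
  obtain ⟨s, ⟨h1, h2⟩, hs⟩ := (hall.and (Ioo_mem_nhdsGT ht.1)).exists
  have hsb : s ∈ openOrders b := ⟨hs.1, (EReal.coe_lt_coe_iff.2 hs.2).trans ht.2⟩
  refine ⟨s, hsb, (hatt.phi_le hsb hq).trans h1.le, ?_⟩
  -- A fixed order `t` bounds `φ'` from above on `(1, t)`, so `(s-1)φ'(s)` is controlled as `s ↓ 1`.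
  have h3 := hconv.monotoneOn_deriv hd hsb ht hs.2.le
  have h4 := hatt.phi_nonneg hsb
  nlinarith [hs.1]

lemma AttainedOn.sc_le_scBound (hatt : H.AttainedOn b) (hb : 1 < b)
    (hconv : ConvexOn ℝ (openOrders b) H.phi)
    (hd : ∀ s ∈ openOrders b, DifferentiableAt ℝ H.phi s)
    (hach : ∀ s ∈ openOrders b, ∀ R η : ℝ, 0 ≤ η → R ≤ s * deriv H.phi s - H.phi s + η →
      H.sc R ≤ (((s - 1) * deriv H.phi s - H.phi s + η : ℝ) : EReal))
    {R : ℝ} (hR : 0 ≤ R) (hRb : (R : EReal) ≤ H.criticalRate b) : H.sc R ≤ H.scBound b R := by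
  rw [← EReal.le_of_forall_lt_iff_le]
  intro z hz
  obtain ⟨c, hc, hcz⟩ := EReal.lt_iff_exists_real_btwn.1 hz
  rw [EReal.coe_lt_coe_iff] at hcz
  have hbound : ∀ s ∈ openOrders b, ((s - 1) * R - H.phi s) / s ≤ c := fun s hs =>
    EReal.coe_le_coe_iff.1 (hatt.scBound_le_iff.1 hc.le s hs)
  set η := z - c with hη
  have hη0 : 0 < η := sub_pos.2 hcz
  -- orders whose rate is just below `R`
  have hclose : ∀ s ∈ openOrders b, s * deriv H.phi s - H.phi s ≤ R →
      R ≤ s * deriv H.phi s - H.phi s + η → H.sc R ≤ z := by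
    intro s hs h1 h2
    refine (hach s hs R η hη0.le h2).trans (EReal.coe_le_coe_iff.2 ?_)
    have h3 := hbound s hs
    rw [div_le_iff₀ (by linarith [hs.1])] at h3
    -- By the identity `s((s-1)φ' - φ) = (s-1)(sφ' - φ) - φ` and the assumption that the rate is at
    -- most `R`.
    have h4 : s * ((s - 1) * deriv H.phi s - H.phi s) ≤ s * c := by nlinarith [hs.1]
    have h5 := le_of_mul_le_mul_left h4 (by linarith [hs.1])
    linarith
  by_cases hA : ∃ s ∈ openOrders b, s * deriv H.phi s - H.phi s ≤ R
  · obtain ⟨s, hs, hsR⟩ := hA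
    -- The slack `η` handles `R = R_b`, which need not be the rate of any order.
    have hex : ∃ t ∈ openOrders b, s ≤ t ∧ R - η < t * deriv H.phi t - H.phi t := by
      have := upTo_neBot hb
      have h1 := (tendsto_psi hconv hd hb).eventually
        (lt_mem_nhds (show ((R - η : ℝ) : EReal) < H.criticalRate b from
          lt_of_lt_of_le (EReal.coe_lt_coe_iff.2 (by linarith)) hRb))
      obtain ⟨t, h2, h3⟩ := (h1.and (eventually_upTo hs.2)).exists
      exact ⟨t, ⟨hs.1.trans h3.1, h3.2⟩, h3.1.le, EReal.coe_lt_coe_iff.1 h2⟩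
    obtain ⟨t, ht, hst, htR⟩ := hex
    rcases le_total (t * deriv H.phi t - H.phi t) R with h | h
    · exact hclose t ht h (by linarith)
    · obtain ⟨u, hu, huR⟩ := exists_eq_of_le_of_le hd hs ht hst hsR h
      exact hclose u hu huR.le (by linarith)
  -- All rates exceed `R`, so every order is achievable without slack, and orders near `1` push the
  -- exponent to `0`. The bound at such an order also shows that `c` is almost nonnegative.
  · push Not at hA
    obtain ⟨s, hs, h1, h2⟩ := hatt.exists_near_one hb hconv hd (half_pos hη0)
    have h3 := hach s hs R 0 le_rfl (by linarith [hA s hs])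
    refine h3.trans (EReal.coe_le_coe_iff.2 ?_)
    have h4 := hbound s hs
    rw [div_le_iff₀ (by linarith [hs.1])] at h4
    have h5 : -(η / 2) ≤ c := by
      by_contra! hcon
      nlinarith [hs.1, mul_nonneg (sub_nonneg.2 hs.1.le) hR]
    linarith

end Problem

end CompositeTesting

theorem theorem2 {X : Type*} [Fintype X] (H : CompositeTesting.Problem X) (b : EReal) (hb : 1 < b)
    (hprod : H.ProductDistributions) (hadd : H.AdditivityOn b) (huniv : H.UniversalOn b)
    (hpara : H.ConvexParametrizationOn b)
    (hsupp : ∃ q ∈ H.base, ∀ x, q x = 0 → H.P x = 0) :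
    (∀ R : ℝ, 0 ≤ R → H.scBound b R ≤ H.sc R) ∧
    (∀ s : ℝ, 1 < s → (s : EReal) < b → DifferentiableAt ℝ H.phi s) ∧
    Filter.Tendsto H.psi (CompositeTesting.upTo b) (nhds (H.criticalRate b)) ∧
    (∀ R : ℝ, 0 ≤ R → (R : EReal) ≤ H.criticalRate b → H.sc R = H.scBound b R) := by
  have hatt : H.AttainedOn b := fun s hs =>
    CompositeTesting.Problem.exists_dominating_eq hpara hsupp hs
  obtain ⟨U, v, hU⟩ :=
    CompositeTesting.Problem.exists_isUniversal hatt hprod hadd huniv hsupp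
  have hconv := CompositeTesting.Problem.convexOn_phi hU
  have hd : ∀ s ∈ CompositeTesting.openOrders b, DifferentiableAt ℝ H.phi s := fun s hs =>
    hatt.differentiableAt_phi hconv hs
  refine ⟨fun R _ => hatt.scBound_le_sc hprod R, fun s h1 h2 => hd s ⟨h1, h2⟩,
    CompositeTesting.Problem.tendsto_psi hconv hd hb, fun R hR hRb => le_antisymm ?_
      (hatt.scBound_le_sc hprod R)⟩
  exact hatt.sc_le_scBound hb hconv hd
    (fun s hs R η hη h => CompositeTesting.Problem.sc_le_of_le hU hs (hd s hs) hη h) hR hRb
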